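/- Let $0<\underline p<\overline p<1$ and $\mu_1\in[0,1]$. There are two arms $a,b$, each with outcomes in $\{-1,0,1\}$; one arm yields $\pm1$ with probability $\underline p/2$ each, and the other yields $\pm1$ with probability $\overline p/2$ each, so that all means are $0$ and $\underline p,\overline p$ are the variances. The pair $\{\underline p,\overline p\}$ is known, but not which arm has which variance; $\mu_1$ is the prior probability that arm $a$ has variance $\underline p$ (and $b$ has $\overline p$), and $\mu_n$ is the Bayesian posterior probability of this event given the first $n-1$ actions and outcomes. A strategy $s=(s_n)_{n\ge1}$ chooses the arm at each stage $n$ as a function $s_n$ of the past actions and outcomes. The strategy $s$ induces the law $P^s$ of the outcome sequence $(X_1,X_2,\dots)$ under which, given the past, the outcome at stage $n$ is distributed according to the predictive law of the chosen arm: if arm $a$ is chosen, $X_n=\pm1$ with probability $\mu_n\underline p/2+(1-\mu_n)\overline p/2$ each, and if arm $b$ is chosen, with probability $(1-\mu_n)\underline p/2+\mu_n\overline p/2$ each. Let $\theta=\sqrt{\underline p/\overline p}$, and let $\varphi_1:[0,\infty)\to\mathbb R$ be three times continuously differentiable with bounded third derivative, $\varphi_1(0)=0$, and strictly increasing and strictly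 concave on $(0,\infty)$. Define $\varphi(x)=\varphi_1(x)$ for $x\ge0$ and $\varphi(x)=-\theta^{-1}\varphi_1(-\theta x)$ for $x<0$ (reference point $c=0$). Put $$U_n(s)=E_{P^s}\Big[\varphi\Big(\frac{X_1+\dots+X_n}{\sqrt n}\Big)\Big],\qquad V_n=\sup_s U_n(s).$$ Let $s^*$ be the strategy that chooses arm $a$ at stage $1$ and, at stage $n>1$, chooses arm $a$ if either $\sum_{j=1}^{n-1}X_j\le0$ and $\mu_n<\tfrac12$, or $\sum_{j=1}^{n-1}X_j>0$ and $\mu_n>\tfrac12$, and chooses arm $b$ otherwise. Then $s^*$ is asymptotically optimal: the limits $\lim_{n\to\infty}U_n(s^*)$ and $\lim_{n\to\infty}V_n$ exist (as real numbers) and are equal. -/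

import Mathlib

open MeasureTheory ProbabilityTheory Filter Topology

/-- The two arms. -/
inductive Arm where
  | a
  | b

/-- The outcomes `-1`, `0`, `1`; the cast `((x : Outcome) : ℝ)` gives the payoff. -/
abbrev Outcome : Type := SignType

instance Outcome.instMeasurableSpace : MeasurableSpace Outcome := ⊤

instance Outcome.instDiscreteMeasurableSpace : DiscreteMeasurableSpace Outcome :=
  ⟨fun _ => trivial⟩

/-! ### Strategies, beliefs and the induced law of outcome sequences

Stages are numbered `0, 1, 2, …` here, so that stage `n` is preceded by `n` past actions and
`n` past outcomes, each given as a tuple indexed by `Fin n`. -/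

/-- A strategy chooses the arm of stage `n` from the past actions and the past outcomes. -/
abbrev Strategy : Type := (n : ℕ) → (Fin n → Arm) → (Fin n → Outcome) → Arm

/-- Primitive one-step-ahead conditionals: given the past actions, the past outcomes and the arm
now considered, the probability law of the outcome of stage `n`. -/
abbrev Beliefs : Type :=
  (n : ℕ) → (Fin n → Arm) → (Fin n → Outcome) → Arm → PMF Outcome

/-- The action history that the strategy `s` generates along an outcome history. -/
def Strategy.actions (s : Strategy) : (n : ℕ) → (Fin n → Outcome) → (Fin n → Arm)
  | 0, _ => Fin.elim0
  | n + 1, ω =>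
    Fin.snoc (s.actions n (Fin.init ω)) (s n (s.actions n (Fin.init ω)) (Fin.init ω))

/-- Law of the outcome of stage `n` given the past outcomes, when `s` is followed: the past
actions are substituted out. -/
noncomputable def stepLaw (B : Beliefs) (s : Strategy) (n : ℕ) (ω : Fin n → Outcome) :
    PMF Outcome :=
  B n (s.actions n ω) ω (s n (s.actions n ω) ω)

/-- `stepLaw` for stage `n + 1`, as a Markov kernel on the coordinates `0, …, n`. -/
noncomputable def stepKernel (B : Beliefs) (s : Strategy) (n : ℕ) :
    Kernel ((_i : Finset.Iic n) → Outcome) Outcome :=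
  Kernel.ofFunOfCountable fun ω =>
    (stepLaw B s (n + 1)
      fun k => ω ⟨k, Finset.mem_Iic.2 (Nat.lt_succ_iff.1 k.isLt)⟩).toMeasure

instance stepKernel.instIsMarkovKernel (B : Beliefs) (s : Strategy) (n : ℕ) :
    IsMarkovKernel (stepKernel B s n) :=
  ⟨fun _ => PMF.toMeasure.isProbabilityMeasure _⟩

/-- The law `P^s` of the infinite outcome sequence under the strategy `s`, obtained by pasting
together the one-step-ahead conditionals (Ionescu-Tulcea). -/
noncomputable def pathLaw (B : Beliefs) (s : Strategy) : Measure (ℕ → Outcome) :=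
  Kernel.trajMeasure (X := fun _ => Outcome) (stepLaw B s 0 Fin.elim0).toMeasure
    (stepKernel B s)

instance pathLaw.instIsProbabilityMeasure (B : Beliefs) (s : Strategy) :
    IsProbabilityMeasure (pathLaw B s) := by
  have : IsProbabilityMeasure (stepLaw B s 0 Fin.elim0).toMeasure :=
    PMF.toMeasure.isProbabilityMeasure _
  unfold pathLaw
  infer_instance

/-! ### Utility, value and asymptotic optimality -/

/-- Expected utility `U_n(s) = E_{P^s}[φ((X_1 + ⋯ + X_n) / √n)]`. -/
noncomputable def expectedUtility (B : Beliefs) (φ : ℝ → ℝ) (n : ℕ) (s : Strategy) : ℝ :=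
  ∫ ω, φ ((∑ i ∈ Finset.range n, ((ω i : Outcome) : ℝ)) / Real.sqrt n) ∂(pathLaw B s)

/-- The set of expected utilities is bounded, so that its supremum below is a genuine one. -/
theorem bddAbove_expectedUtility (B : Beliefs) (φ : ℝ → ℝ) (n : ℕ) :
    BddAbove (Set.range (expectedUtility B φ n)) := by
  have hfin : (Set.range fun x : Fin n → Outcome =>
      ‖φ ((∑ i, ((x i : Outcome) : ℝ)) / Real.sqrt n)‖).Finite := Set.finite_range _
  obtain ⟨C, hC⟩ := hfin.bddAbove
  refine ⟨C, ?_⟩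
  rintro _ ⟨s, rfl⟩
  have h : ∀ ω : ℕ → Outcome,
      ‖φ ((∑ i ∈ Finset.range n, ((ω i : Outcome) : ℝ)) / Real.sqrt n)‖ ≤ C := by
    intro ω
    rw [← Fin.sum_univ_eq_sum_range (fun i => ((ω i : Outcome) : ℝ)) n]
    exact hC ⟨fun i => ω i, rfl⟩
  have h2 := norm_integral_le_of_norm_le_const (μ := pathLaw B s) (Eventually.of_forall h)
  simp only [probReal_univ, mul_one] at h2
  exact (le_abs_self _).trans h2

/-- The value `V_n = sup_s U_n(s)` of the `n`-horizon problem. -/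
noncomputable def value (B : Beliefs) (φ : ℝ → ℝ) (n : ℕ) : ℝ :=
  ⨆ s : Strategy, expectedUtility B φ n s

/-- `s` is asymptotically optimal: `lim U_n(s)` and `lim V_n` exist and are equal. -/
def AsymptoticallyOptimal (B : Beliefs) (φ : ℝ → ℝ) (s : Strategy) : Prop :=
  ∃ V : ℝ, Tendsto (value B φ) atTop (𝓝 V) ∧
    Tendsto (fun n => expectedUtility B φ n s) atTop (𝓝 V)

/-- The utility index with reference point `c`: `φ₁ (x - c)` for gains and
`-θ⁻¹ φ₁ (-θ (x - c))` for losses. -/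
noncomputable def utilityIndex (φ₁ : ℝ → ℝ) (θ c x : ℝ) : ℝ :=
  if c ≤ x then φ₁ (x - c) else -θ⁻¹ * φ₁ (-θ * (x - c))

/-- Conditions on the index for gains, a function on `[0, ∞)` (its values at negative arguments
are irrelevant): it vanishes at `0`, is three times continuously differentiable on `[0, ∞)`
(one-sidedly at `0`) with bounded third derivative, and is strictly increasing and strictly
concave on the gains. -/
structure GainIndex (φ₁ : ℝ → ℝ) : Prop where
  map_zero : φ₁ 0 = 0
  contDiffOn : ContDiffOn ℝ 3 φ₁ (Set.Ici 0)
  bounded_third : ∃ C : ℝ, ∀ x ∈ Set.Ici (0 : ℝ),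
    |iteratedDerivWithin 3 φ₁ (Set.Ici 0) x| ≤ C
  strictMonoOn : StrictMonoOn φ₁ (Set.Ioi 0)
  strictConcaveOn : StrictConcaveOn ℝ (Set.Ioi 0) φ₁

/-! ### The two-armed bandit with unknown identity of the high-variance arm -/

/-- Known data: the two variances `0 < pLow < pHigh < 1`, and the prior probability that arm `a`
is the one with variance `pLow`. -/
structure TwoArmedBandit where
  pLow : ℝ
  pHigh : ℝ
  prior : ℝ
  pLow_pos : 0 < pLow
  pLow_lt_pHigh : pLow < pHigh
  pHigh_lt_one : pHigh < 1
  prior_nonneg : 0 ≤ prior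
  prior_le_one : prior ≤ 1

/-- Probability of the outcome `x` of an arm with variance `p`: `1` and `-1` have probability
`p / 2` each. -/
noncomputable def armProb (p : ℝ) (x : Outcome) : ℝ := if x = 0 then 1 - p else p / 2

theorem armProb_pos {p : ℝ} (h0 : 0 < p) (h1 : p < 1) (x : Outcome) : 0 < armProb p x := by
  unfold armProb
  split_ifs <;> linarith

theorem sum_armProb (p : ℝ) : ∑ x : Outcome, armProb p x = 1 := by
  have : (Finset.univ : Finset Outcome) = {0, -1, 1} := by decide
  rw [this]
  simp [armProb]

namespace TwoArmedBandit

variable (M : TwoArmedBandit)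

/-- Probability that `arm` yields `x` if arm `a` has variance `pLow` and `b` has `pHigh`. -/
noncomputable def likLow : Arm → Outcome → ℝ
  | .a, x => armProb M.pLow x
  | .b, x => armProb M.pHigh x

/-- Probability that `arm` yields `x` if arm `a` has variance `pHigh` and `b` has `pLow`. -/
noncomputable def likHigh : Arm → Outcome → ℝ
  | .a, x => armProb M.pHigh x
  | .b, x => armProb M.pLow x

/-- Predictive probability of `x` from `arm` when `a` has variance `pLow` with probability `m`. -/
noncomputable def predProb (m : ℝ) (arm : Arm) (x : Outcome) : ℝ :=
  m * M.likLow arm x + (1 - m) * M.likHigh arm x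

/-- The Bayesian posterior probability `μ` that arm `a` has variance `pLow`. -/
noncomputable def posterior : (n : ℕ) → (Fin n → Arm) → (Fin n → Outcome) → ℝ
  | 0, _, _ => M.prior
  | n + 1, α, ω =>
    posterior n (Fin.init α) (Fin.init ω) * M.likLow (α (Fin.last n)) (ω (Fin.last n)) /
      M.predProb (posterior n (Fin.init α) (Fin.init ω)) (α (Fin.last n)) (ω (Fin.last n))

theorem likLow_pos (arm : Arm) (x : Outcome) : 0 < M.likLow arm x := by
  have h1 := M.pLow_pos
  have h2 := M.pLow_lt_pHigh
  have h3 := M.pHigh_lt_one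
  cases arm
  · exact armProb_pos h1 (h2.trans h3) x
  · exact armProb_pos (h1.trans h2) h3 x

theorem likHigh_pos (arm : Arm) (x : Outcome) : 0 < M.likHigh arm x := by
  have h1 := M.pLow_pos
  have h2 := M.pLow_lt_pHigh
  have h3 := M.pHigh_lt_one
  cases arm
  · exact armProb_pos (h1.trans h2) h3 x
  · exact armProb_pos h1 (h2.trans h3) x

theorem predProb_nonneg {m : ℝ} (hm : m ∈ Set.Icc (0 : ℝ) 1) (arm : Arm) (x : Outcome) :
    0 ≤ M.predProb m arm x :=
  add_nonneg (mul_nonneg hm.1 (M.likLow_pos arm x).le)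
    (mul_nonneg (sub_nonneg.2 hm.2) (M.likHigh_pos arm x).le)

theorem sum_predProb (m : ℝ) (arm : Arm) : ∑ x : Outcome, M.predProb m arm x = 1 := by
  have h1 : ∑ x : Outcome, M.likLow arm x = 1 := by cases arm <;> exact sum_armProb _
  have h2 : ∑ x : Outcome, M.likHigh arm x = 1 := by cases arm <;> exact sum_armProb _
  simp only [predProb, Finset.sum_add_distrib, ← Finset.mul_sum, h1, h2]
  ring

theorem posterior_mem : ∀ (n : ℕ) (α : Fin n → Arm) (ω : Fin n → Outcome),
    M.posterior n α ω ∈ Set.Icc (0 : ℝ) 1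
  | 0, _, _ => ⟨M.prior_nonneg, M.prior_le_one⟩
  | n + 1, α, ω => by
    have ih := posterior_mem n (Fin.init α) (Fin.init ω)
    have hp := M.predProb_nonneg ih (α (Fin.last n)) (ω (Fin.last n))
    have hl := (M.likLow_pos (α (Fin.last n)) (ω (Fin.last n))).le
    refine ⟨div_nonneg (mul_nonneg ih.1 hl) hp, div_le_one_of_le₀ ?_ hp⟩
    exact le_add_of_nonneg_right
      (mul_nonneg (sub_nonneg.2 ih.2) (M.likHigh_pos _ _).le)

/-- The one-step-ahead conditionals: predictive probabilities under the current posterior. -/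
noncomputable def beliefs : Beliefs := fun n α ω arm =>
  PMF.ofFintype (fun x => ENNReal.ofReal (M.predProb (M.posterior n α ω) arm x)) (by
    rw [← ENNReal.ofReal_sum_of_nonneg
      fun x _ => M.predProb_nonneg (M.posterior_mem n α ω) arm x, M.sum_predProb,
      ENNReal.ofReal_one])

open Classical in
/-- The myopic strategy: arm `a` first; afterwards arm `a` if cumulative payoffs are nonpositive
and `a` is believed more likely to have the high variance, or cumulative payoffs are positive and
`a` is believed more likely to have the low variance; otherwise arm `b`. -/
noncomputable def myopic : Strategy := fun n α ω =>
  if n = 0 ∨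
      (∑ i, ((ω i : Outcome) : ℝ) ≤ 0 ∧ M.posterior n α ω < 1 / 2) ∨
      (0 < ∑ i, ((ω i : Outcome) : ℝ) ∧ 1 / 2 < M.posterior n α ω)
  then Arm.a else Arm.b

/-- The ratio `θ` of the low to the high standard deviation. -/
noncomputable def theta : ℝ := Real.sqrt M.pLow / Real.sqrt M.pHigh

end TwoArmedBandit

/-! The common limit is `0`. Let `q`, `P` be the low and high variances, so that `θ² P = q`. Replace
`φ` by a smooth `u = lossRescale θ f`, with `f` odd and concave on the gains. Then `u''` is
nonpositive on gains and nonnegative on losses, so variance `q` is best on gains and `P` on losses.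
One stage with payoff step `r` and predictive variance `p` adds `r² p u'' / 2` up to `O(r³)`.

The candidate value function with `j` stages to go is `lossRescale θ (A^j f)`, where `A` averages
over `[x - δ, x + δ]` with `δ² = 3 q r²`. One `A` adds `r² q f'' / 2`, which after rescaling is
exactly `q` on gains and `P` on losses. The iterates stay odd with the same sign of `f''` and the
same bounds, so the error per stage is uniform. Hence the value along any strategy is a
supermartingale up to `O(r³)` per stage (`stageValue_succ_le`). It starts at `0` by oddness, and `n`
stages with `r = 1/√n` cost `O(1/√n)`.

For the myopic strategy the inequality reverses, up to the error of misidentifying the arms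
(`le_stageValue_myopic_succ`). That error is controlled by `√(μ(1-μ))`, whose expectation contracts
by the Hellinger affinity at every stage under every strategy (`integral_sqrt_posterior_succ`). The
total is a convergent geometric sum times `r²`, which vanishes. -/

/-! ### Averages over intervals -/

/-- The average of `f` over `[x - δ, x + δ]`. -/
noncomputable def intervalAvg (δ : ℝ) (f : ℝ → ℝ) (x : ℝ) : ℝ :=
  (∫ u in (x - δ)..(x + δ), f u) / (2 * δ)

theorem intervalAvg_eq_shift (δ : ℝ) (f : ℝ → ℝ) (x : ℝ) :
    intervalAvg δ f x = (∫ u in (-δ)..δ, f (x + u)) / (2 * δ) := by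
  rw [intervalAvg, intervalIntegral.integral_comp_add_left (fun u => f u) x]
  simp [sub_eq_add_neg]

theorem intervalAvg_neg (δ : ℝ) (f : ℝ → ℝ) (x : ℝ) :
    intervalAvg δ f (-x) = intervalAvg δ (fun u => f (-u)) x := by
  rw [intervalAvg, intervalAvg, intervalIntegral.integral_comp_neg (fun u => f u)]
  congr 2 <;> ring

theorem intervalAvg_of_odd {δ : ℝ} {f : ℝ → ℝ} (hf : ∀ x, f (-x) = -f x) (x : ℝ) :
    intervalAvg δ f (-x) = -intervalAvg δ f x := by
  rw [intervalAvg_neg]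
  simp [hf, intervalAvg, neg_div]

theorem intervalAvg_of_even {δ : ℝ} {f : ℝ → ℝ} (hf : ∀ x, f (-x) = f x) (x : ℝ) :
    intervalAvg δ f (-x) = intervalAvg δ f x := by
  rw [intervalAvg_neg]
  simp [hf]

/-- Averaging gains one derivative, given by a difference quotient. This drives both the smoothing
of the utility and the sign of the second derivative of averages. -/
theorem hasDerivAt_intervalAvg {δ : ℝ} {f : ℝ → ℝ} (hf : Continuous f) (x : ℝ) :
    HasDerivAt (intervalAvg δ f) ((f (x + δ) - f (x - δ)) / (2 * δ)) x := by
  have h (c : ℝ) : HasDerivAt (fun y => ∫ u in (0 : ℝ)..(y + c), f u) (f (x + c)) x := by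
    have h1 := (hf.integral_hasStrictDerivAt 0 (x + c)).hasDerivAt
    exact h1.comp_add_const x c
  have h2 := ((h δ).sub (h (-δ))).div_const (2 * δ)
  refine (h2.congr_of_eventuallyEq (Eventually.of_forall fun y => ?_))
  simp only [intervalAvg, Pi.sub_apply]
  rw [intervalIntegral.integral_interval_sub_left (hf.intervalIntegrable _ _)
    (hf.intervalIntegrable _ _), ← sub_eq_add_neg]

theorem intervalAvg_of_hasDerivAt {δ : ℝ} {f f' : ℝ → ℝ} (hf : ∀ x, HasDerivAt f (f' x) x)
    (hf' : Continuous f') (x : ℝ) :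
    intervalAvg δ f' x = (f (x + δ) - f (x - δ)) / (2 * δ) := by
  rw [intervalAvg, intervalIntegral.integral_eq_sub_of_hasDerivAt (fun u _ => hf u)
    (hf'.intervalIntegrable _ _)]

theorem continuous_intervalAvg {δ : ℝ} {f : ℝ → ℝ} (hf : Continuous f) :
    Continuous (intervalAvg δ f) :=
  continuous_iff_continuousAt.2 fun x => (hasDerivAt_intervalAvg hf x).continuousAt

theorem intervalAvg_const {δ : ℝ} (hδ : 0 < δ) (c x : ℝ) : intervalAvg δ (fun _ => c) x = c := by
  simp only [intervalAvg, intervalIntegral.integral_const, smul_eq_mul]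
  field_simp
  ring

/-- If `f (x + u)` stays within `C` of `f₀ (y + u)` for `|u| ≤ δ`, so do the averages. -/
theorem abs_intervalAvg_sub_le {δ C : ℝ} (hδ : 0 < δ) {f f₀ : ℝ → ℝ} (hf : Continuous f)
    (hf₀ : Continuous f₀) {x y : ℝ} (h : ∀ u, |u| ≤ δ → |f (x + u) - f₀ (y + u)| ≤ C) :
    |intervalAvg δ f x - intervalAvg δ f₀ y| ≤ C := by
  rw [intervalAvg_eq_shift, intervalAvg_eq_shift, ← sub_div,
    ← intervalIntegral.integral_sub ((by fun_prop : Continuous _).intervalIntegrable _ _)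
      ((by fun_prop : Continuous _).intervalIntegrable _ _), abs_div,
    abs_of_pos (by positivity : 0 < 2 * δ), div_le_iff₀ (by positivity)]
  have := intervalIntegral.norm_integral_le_of_norm_le_const (a := -δ) (b := δ)
    (f := fun u => f (x + u) - f₀ (y + u)) (C := C) fun u hu => by
      rw [Set.uIoc_of_le (by linarith)] at hu
      exact h u (abs_le.2 ⟨hu.1.le, hu.2⟩)
  rw [Real.norm_eq_abs, sub_neg_eq_add, ← two_mul, abs_of_pos (by positivity : 0 < 2 * δ)] at this
  exact this

theorem abs_intervalAvg_le {δ B : ℝ} (hδ : 0 < δ) {f : ℝ → ℝ} (hf : Continuous f)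
    (h : ∀ x, |f x| ≤ B) (x : ℝ) : |intervalAvg δ f x| ≤ B := by
  have := abs_intervalAvg_sub_le hδ hf (continuous_const (y := (0 : ℝ))) (x := x) (y := x) (C := B)
    fun u _ => by simpa using h (x + u)
  simpa [intervalAvg_const hδ] using this

/-! ### Mean value and Taylor estimates -/

theorem abs_sub_le_of_abs_hasDerivAt_le {f f' : ℝ → ℝ} {C : ℝ}
    (hf : ∀ x, HasDerivAt f (f' x) x) (hC : ∀ x, |f' x| ≤ C) (x y : ℝ) :
    |f x - f y| ≤ C * |x - y| :=
  Convex.norm_image_sub_le_of_norm_hasDerivWithin_le (s := Set.univ)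
    (fun z _ => (hf z).hasDerivWithinAt) (fun z _ => hC z) convex_univ (Set.mem_univ y)
    (Set.mem_univ x)

theorem abs_sub_zero_le_of_abs_hasDerivAt_le {f f' : ℝ → ℝ} {C y : ℝ}
    (hf : ∀ x, HasDerivAt f (f' x) x) (hC : ∀ t, |t| ≤ |y| → |f' t| ≤ C) :
    |f y - f 0| ≤ C * |y| := by
  have := Convex.norm_image_sub_le_of_norm_hasDerivWithin_le (s := Metric.closedBall (0 : ℝ) |y|)
    (f := f) (f' := f') (C := C) (fun z _ => (hf z).hasDerivWithinAt)
    (fun z hz => hC z (by simpa using hz)) (convex_closedBall _ _)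
    (x := 0) (y := y) (by simp) (by simp)
  simpa using this

/-- Two applications of the mean value inequality. Only a Lipschitz `f₂` is required, because
rescaled losses may leave a kink in the second derivative at `0`. -/
theorem abs_taylor_two_le {f f₁ f₂ : ℝ → ℝ} {K : ℝ} (hf : ∀ x, HasDerivAt f (f₁ x) x)
    (hf₁ : ∀ x, HasDerivAt f₁ (f₂ x) x) (hK : ∀ x y, |f₂ x - f₂ y| ≤ K * |x - y|) (x y : ℝ) :
    |f (x + y) - f x - y * f₁ x - y ^ 2 / 2 * f₂ x| ≤ K * |y| ^ 3 := by
  have hK0 : 0 ≤ K := by simpa using (abs_nonneg _).trans (hK 1 0)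
  have h1 (t : ℝ) : |f₁ (x + t) - f₁ x - t * f₂ x| ≤ K * |t| * |t| := by
    have := abs_sub_zero_le_of_abs_hasDerivAt_le (y := t) (C := K * |t|)
      (f := fun s => f₁ (x + s) - f₁ x - s * f₂ x) (f' := fun s => f₂ (x + s) - 1 * f₂ x)
      (fun s => (((hf₁ (x + s)).comp_const_add x s).sub_const _).sub
        ((hasDerivAt_id s).mul_const _))
      (fun s hs => by
        have := hK (x + s) x
        simp only [add_sub_cancel_left, one_mul] at this ⊢
        exact this.trans (by gcongr))
    simpa using this
  have h2 := abs_sub_zero_le_of_abs_hasDerivAt_le (y := y) (C := K * |y| * |y|)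
    (f := fun s => f (x + s) - f x - s * f₁ x - s ^ 2 / 2 * f₂ x)
    (f' := fun s => f₁ (x + s) - 1 * f₁ x - ((2 : ℕ) * s ^ (2 - 1)) / 2 * f₂ x)
    (fun s => ((((hf (x + s)).comp_const_add x s).sub_const _).sub
        ((hasDerivAt_id s).mul_const _)).sub (((hasDerivAt_pow 2 s).div_const 2).mul_const _))
    (fun s hs => by
      have : f₁ (x + s) - 1 * f₁ x - ((2 : ℕ) * s ^ (2 - 1)) / 2 * f₂ x
          = f₁ (x + s) - f₁ x - s * f₂ x := by
        norm_num
      rw [this]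
      exact (h1 s).trans (by gcongr))
  calc _ ≤ K * |y| * |y| * |y| := by simpa using h2
    _ = _ := by ring

/-- The uniform law on `[-δ, δ]` has mean `0` and variance `δ² / 3`; half of the latter multiplies
`f₂`. -/
theorem abs_intervalAvg_sub_taylor_le {f f₁ f₂ : ℝ → ℝ} {K δ : ℝ} (hδ : 0 < δ)
    (hf : ∀ x, HasDerivAt f (f₁ x) x) (hf₁ : ∀ x, HasDerivAt f₁ (f₂ x) x)
    (hK : ∀ x y, |f₂ x - f₂ y| ≤ K * |x - y|) (x : ℝ) :
    |intervalAvg δ f x - f x - δ ^ 2 / 6 * f₂ x| ≤ K * δ ^ 3 := by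
  have hK0 : 0 ≤ K := by simpa using (abs_nonneg _).trans (hK 1 0)
  have hc : Continuous f := continuous_iff_continuousAt.2 fun x => (hf x).continuousAt
  have h := abs_intervalAvg_sub_le (C := K * δ ^ 3) (x := x) (y := x) hδ hc
    (f₀ := fun z => f x + (z - x) * f₁ x + (z - x) ^ 2 * (f₂ x / 2)) (by fun_prop) fun u hu => by
      have := abs_taylor_two_le hf hf₁ hK x u
      have h2 : K * |u| ^ 3 ≤ K * δ ^ 3 := by gcongr
      refine le_trans (le_of_eq ?_) (this.trans h2)
      congr 1
      ring
  have h2 : intervalAvg δ (fun z => f x + (z - x) * f₁ x + (z - x) ^ 2 * (f₂ x / 2)) x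
      = f x + δ ^ 2 / 6 * f₂ x := by
    rw [intervalAvg_eq_shift]
    simp only [add_sub_cancel_left]
    rw [intervalIntegral.integral_add ((by fun_prop : Continuous _).intervalIntegrable _ _)
      ((by fun_prop : Continuous _).intervalIntegrable _ _),
      intervalIntegral.integral_add ((by fun_prop : Continuous _).intervalIntegrable _ _)
      ((by fun_prop : Continuous _).intervalIntegrable _ _),
      intervalIntegral.integral_mul_const, intervalIntegral.integral_mul_const, integral_pow,
      integral_id, intervalIntegral.integral_const, smul_eq_mul]
    push_cast
    field_simp
    ring
  rw [h2, ← sub_sub] at h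
  exact h

/-! ### Odd functions that are concave on the positive half-line -/

/-- `f` is odd with first two derivatives `f₁`, `f₂`; the second one is continuous, bounded by `B`
and nonpositive on `[0, ∞)`. -/
structure OddConcave (f f₁ f₂ : ℝ → ℝ) (B : ℝ) : Prop where
  odd : ∀ x, f (-x) = -f x
  even_deriv : ∀ x, f₁ (-x) = f₁ x
  odd_second : ∀ x, f₂ (-x) = -f₂ x
  hasDerivAt : ∀ x, HasDerivAt f (f₁ x) x
  hasDerivAt_deriv : ∀ x, HasDerivAt f₁ (f₂ x) x
  continuous_second : Continuous f₂
  abs_second_le : ∀ x, |f₂ x| ≤ B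
  second_nonpos : ∀ x, 0 ≤ x → f₂ x ≤ 0

theorem le_of_even_of_antitoneOn {f : ℝ → ℝ} (he : ∀ x, f (-x) = f x)
    (ha : AntitoneOn f (Set.Ici 0)) {x δ : ℝ} (hx : 0 ≤ x) (hδ : 0 ≤ δ) :
    f (x + δ) ≤ f (x - δ) := by
  rcases le_total δ x with h | h
  · exact ha (Set.mem_Ici.2 (by linarith)) (Set.mem_Ici.2 (by linarith)) (by linarith)
  · rw [← he (x - δ)]
    exact ha (Set.mem_Ici.2 (by linarith)) (Set.mem_Ici.2 (by linarith)) (by linarith)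

/-- Averaging an odd function with an even derivative that decreases on `[0, ∞)`. -/
theorem OddConcave.intervalAvg_of_antitoneOn {g g₁ : ℝ → ℝ} {L δ : ℝ} (hδ : 0 < δ)
    (hodd : ∀ x, g (-x) = -g x) (heven : ∀ x, g₁ (-x) = g₁ x)
    (hg : ∀ x, HasDerivAt g (g₁ x) x) (hc : Continuous g₁) (hL : ∀ x, |g₁ x| ≤ L)
    (ha : AntitoneOn g₁ (Set.Ici 0)) :
    OddConcave (intervalAvg δ g) (intervalAvg δ g₁)
      (fun x => (g₁ (x + δ) - g₁ (x - δ)) / (2 * δ)) (L / δ) where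
  odd := intervalAvg_of_odd hodd
  even_deriv := intervalAvg_of_even heven
  odd_second x := by
    rw [← heven (-x + δ), ← heven (-x - δ), ← neg_div]
    ring_nf
  hasDerivAt x := by
    rw [intervalAvg_of_hasDerivAt hg hc]
    exact hasDerivAt_intervalAvg (continuous_iff_continuousAt.2 fun x => (hg x).continuousAt) x
  hasDerivAt_deriv := hasDerivAt_intervalAvg hc
  continuous_second := by fun_prop
  abs_second_le x := by
    rw [abs_div, abs_of_pos (by positivity : 0 < 2 * δ), div_le_div_iff₀ (by positivity) hδ]
    have := abs_sub (g₁ (x + δ)) (g₁ (x - δ))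
    nlinarith [hL (x + δ), hL (x - δ)]
  second_nonpos x hx :=
    div_nonpos_of_nonpos_of_nonneg (sub_nonpos.2 (le_of_even_of_antitoneOn heven ha hx hδ.le))
      (by positivity)

namespace OddConcave

variable {f f₁ f₂ : ℝ → ℝ} {B : ℝ}

theorem map_zero (h : OddConcave f f₁ f₂ B) : f 0 = 0 := by
  have := h.odd 0
  simp only [neg_zero] at this
  linarith

theorem second_zero (h : OddConcave f f₁ f₂ B) : f₂ 0 = 0 := by
  have := h.odd_second 0
  simp only [neg_zero] at this
  linarith

theorem second_nonneg (h : OddConcave f f₁ f₂ B) {x : ℝ} (hx : x ≤ 0) : 0 ≤ f₂ x := by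
  have := h.second_nonpos (-x) (by linarith)
  rw [h.odd_second] at this
  linarith

theorem continuous (h : OddConcave f f₁ f₂ B) : Continuous f :=
  continuous_iff_continuousAt.2 fun x => (h.hasDerivAt x).continuousAt

theorem continuous_deriv (h : OddConcave f f₁ f₂ B) : Continuous f₁ :=
  continuous_iff_continuousAt.2 fun x => (h.hasDerivAt_deriv x).continuousAt

theorem antitoneOn_deriv (h : OddConcave f f₁ f₂ B) : AntitoneOn f₁ (Set.Ici 0) := by
  refine antitoneOn_of_hasDerivWithinAt_nonpos (f' := f₂) (convex_Ici 0)
    h.continuous_deriv.continuousOn (fun x _ => (h.hasDerivAt_deriv x).hasDerivWithinAt) ?_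
  intro x hx
  rw [interior_Ici, Set.mem_Ioi] at hx
  exact h.second_nonpos x hx.le

/-- Near `0` the average of `f₂` mixes both signs, so its sign is not inherited pointwise. It is a
difference quotient of `f₁`, which is even and decreasing in `|x|`, and `|x - δ| ≤ x + δ` for `x ≥
0`. -/
theorem intervalAvg (h : OddConcave f f₁ f₂ B) {δ : ℝ} (hδ : 0 < δ) :
    OddConcave (intervalAvg δ f) (intervalAvg δ f₁) (intervalAvg δ f₂) B where
  odd := intervalAvg_of_odd h.odd
  even_deriv := intervalAvg_of_even h.even_deriv
  odd_second := intervalAvg_of_odd h.odd_second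
  hasDerivAt x := by
    rw [intervalAvg_of_hasDerivAt h.hasDerivAt h.continuous_deriv]
    exact hasDerivAt_intervalAvg h.continuous x
  hasDerivAt_deriv x := by
    rw [intervalAvg_of_hasDerivAt h.hasDerivAt_deriv h.continuous_second]
    exact hasDerivAt_intervalAvg h.continuous_deriv x
  continuous_second := continuous_intervalAvg h.continuous_second
  abs_second_le := abs_intervalAvg_le hδ h.continuous_second h.abs_second_le
  second_nonpos x hx := by
    rw [intervalAvg_of_hasDerivAt h.hasDerivAt_deriv h.continuous_second]
    exact div_nonpos_of_nonpos_of_nonneg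
      (sub_nonpos.2 (le_of_even_of_antitoneOn h.even_deriv h.antitoneOn_deriv hx hδ.le))
      (by positivity)

theorem lipschitz_intervalAvg_second (h : OddConcave f f₁ f₂ B) {δ : ℝ} (hδ : 0 < δ) (x y : ℝ) :
    |_root_.intervalAvg δ f₂ x - _root_.intervalAvg δ f₂ y| ≤ B / δ * |x - y| := by
  refine abs_sub_le_of_abs_hasDerivAt_le (hasDerivAt_intervalAvg h.continuous_second)
    (fun z => ?_) x y
  rw [abs_div, abs_of_pos (by positivity : 0 < 2 * δ), div_le_div_iff₀ (by positivity) hδ]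
  have := abs_sub (f₂ (z + δ)) (f₂ (z - δ))
  nlinarith [h.abs_second_le (z + δ), h.abs_second_le (z - δ)]

theorem intervalAvg_second_lipschitz (h : OddConcave f f₁ f₂ B) {K δ : ℝ} (hδ : 0 < δ)
    (hK : ∀ x y, |f₂ x - f₂ y| ≤ K * |x - y|) (x y : ℝ) :
    |_root_.intervalAvg δ f₂ x - _root_.intervalAvg δ f₂ y| ≤ K * |x - y| :=
  abs_intervalAvg_sub_le hδ h.continuous_second h.continuous_second fun u _ => by
    simpa using hK (x + u) (y + u)

/-- The constants `B` and `K` depend neither on `k` nor on `δ`, which makes the error per stage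
uniform over the horizon. -/
theorem intervalAvg_iterate (h : OddConcave f f₁ f₂ B) {K δ : ℝ} (hδ : 0 < δ)
    (hK : ∀ x y, |f₂ x - f₂ y| ≤ K * |x - y|) (k : ℕ) :
    OddConcave ((_root_.intervalAvg δ)^[k] f) ((_root_.intervalAvg δ)^[k] f₁)
        ((_root_.intervalAvg δ)^[k] f₂) B ∧
      ∀ x y, |(_root_.intervalAvg δ)^[k] f₂ x - (_root_.intervalAvg δ)^[k] f₂ y|
        ≤ K * |x - y| := by
  induction k with
  | zero => exact ⟨h, hK⟩
  | succ k ih =>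
    simp only [Function.iterate_succ_apply']
    exact ⟨ih.1.intervalAvg hδ, ih.1.intervalAvg_second_lipschitz hδ ih.2⟩

end OddConcave

/-! ### Rescaling the losses -/

/-- `f` on the gains and `θ⁻¹ f (θ x)` on the losses. -/
noncomputable def lossRescale (θ : ℝ) (f : ℝ → ℝ) (x : ℝ) : ℝ :=
  if 0 ≤ x then f x else θ⁻¹ * f (θ * x)

theorem hasDerivAt_ite_nonneg {a b a' b' : ℝ → ℝ} (ha : ∀ x, HasDerivAt a (a' x) x)
    (hb : ∀ x, HasDerivAt b (b' x) x) (h : a 0 = b 0) (h' : a' 0 = b' 0) (x : ℝ) :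
    HasDerivAt (fun x => if 0 ≤ x then a x else b x) (if 0 ≤ x then a' x else b' x) x := by
  rcases lt_trichotomy x 0 with hx | rfl | hx
  · rw [if_neg hx.not_ge]
    refine (hb x).congr_of_eventuallyEq ?_
    filter_upwards [eventually_lt_nhds hx] with y hy
    rw [if_neg hy.not_ge]
  · rw [if_pos le_rfl, ← hasDerivWithinAt_univ, ← Set.Iic_union_Ici (a := (0 : ℝ))]
    refine HasDerivWithinAt.union ?_ ?_
    · rw [h']
      refine (hb 0).hasDerivWithinAt.congr (fun y hy => ?_) (by simp [h])
      rcases eq_or_lt_of_le (Set.mem_Iic.1 hy) with rfl | hy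
      · simp [h]
      · rw [if_neg hy.not_ge]
    · exact (ha 0).hasDerivWithinAt.congr (fun y hy => if_pos hy) (if_pos le_rfl)
  · rw [if_pos hx.le]
    refine (ha x).congr_of_eventuallyEq ?_
    filter_upwards [eventually_gt_nhds hx] with y hy
    rw [if_pos hy.le]

theorem abs_lossRescale_sub_le {θ C : ℝ} (h0 : 0 < θ) (h1 : θ ≤ 1) {f g : ℝ → ℝ}
    (h : ∀ x, |f x - g x| ≤ C) (x : ℝ) :
    |lossRescale θ f x - lossRescale θ g x| ≤ θ⁻¹ * C := by
  have hC : 0 ≤ C := (abs_nonneg _).trans (h 0)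
  have h2 : 1 ≤ θ⁻¹ := (one_le_inv₀ h0).2 h1
  unfold lossRescale
  split_ifs
  · nlinarith [h x]
  · rw [← mul_sub, abs_mul, abs_of_pos (inv_pos.2 h0)]
    gcongr
    exact h _

/-- The second derivative of `lossRescale θ f` in terms of that of `f`. -/
noncomputable def lossRescaleSecond (θ : ℝ) (f₂ : ℝ → ℝ) (x : ℝ) : ℝ :=
  if 0 ≤ x then f₂ x else θ * f₂ (θ * x)

namespace OddConcave

variable {f f₁ f₂ : ℝ → ℝ} {B θ : ℝ}

theorem hasDerivAt_lossRescale (h : OddConcave f f₁ f₂ B) (h0 : 0 < θ) (x : ℝ) :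
    HasDerivAt (lossRescale θ f) (if 0 ≤ x then f₁ x else f₁ (θ * x)) x := by
  refine hasDerivAt_ite_nonneg h.hasDerivAt (b' := fun x => f₁ (θ * x)) (fun x => ?_)
    (by simp [h.map_zero]) (by simp) x
  have := ((h.hasDerivAt (θ * x)).comp x ((hasDerivAt_id x).const_mul θ)).const_mul θ⁻¹
  refine this.congr_deriv ?_
  field_simp

/-- The one-sided second derivatives at `0` are `f₂ 0` and `θ * f₂ 0`; they agree because oddness
forces `f₂ 0 = 0`. -/
theorem hasDerivAt_lossRescale_deriv (h : OddConcave f f₁ f₂ B) (x : ℝ) :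
    HasDerivAt (fun x => if 0 ≤ x then f₁ x else f₁ (θ * x)) (lossRescaleSecond θ f₂ x) x := by
  refine hasDerivAt_ite_nonneg h.hasDerivAt_deriv (b' := fun x => θ * f₂ (θ * x)) (fun x => ?_)
    (by simp) (by simp [h.second_zero]) x
  have := (h.hasDerivAt_deriv (θ * x)).comp x ((hasDerivAt_id x).const_mul θ)
  refine this.congr_deriv ?_
  ring

theorem abs_lossRescaleSecond_le (h : OddConcave f f₁ f₂ B) (h0 : 0 < θ) (h1 : θ ≤ 1) (x : ℝ) :
    |lossRescaleSecond θ f₂ x| ≤ B := by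
  unfold lossRescaleSecond
  split_ifs
  · exact h.abs_second_le x
  · rw [abs_mul, abs_of_pos h0]
    have := h.abs_second_le (θ * x)
    nlinarith [abs_nonneg (f₂ (θ * x))]

theorem lossRescaleSecond_nonpos (h : OddConcave f f₁ f₂ B) {x : ℝ} (hx : 0 ≤ x) :
    lossRescaleSecond θ f₂ x ≤ 0 := by
  rw [lossRescaleSecond, if_pos hx]
  exact h.second_nonpos x hx

theorem lossRescaleSecond_zero (h : OddConcave f f₁ f₂ B) : lossRescaleSecond θ f₂ 0 = 0 := by
  rw [lossRescaleSecond, if_pos le_rfl, h.second_zero]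

theorem lossRescaleSecond_nonneg (h : OddConcave f f₁ f₂ B) (h0 : 0 < θ) {x : ℝ} (hx : x ≤ 0) :
    0 ≤ lossRescaleSecond θ f₂ x := by
  rcases eq_or_lt_of_le hx with rfl | hx
  · rw [h.lossRescaleSecond_zero]
  · rw [lossRescaleSecond, if_neg hx.not_ge]
    exact mul_nonneg h0.le (h.second_nonneg (mul_nonpos_of_nonneg_of_nonpos h0.le hx.le))

theorem lossRescaleSecond_lipschitz (h : OddConcave f f₁ f₂ B) (h0 : 0 < θ) (h1 : θ ≤ 1) {K : ℝ}
    (hK : ∀ x y, |f₂ x - f₂ y| ≤ K * |x - y|) (x y : ℝ) :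
    |lossRescaleSecond θ f₂ x - lossRescaleSecond θ f₂ y| ≤ K * |x - y| := by
  have hK0 : 0 ≤ K := by simpa using (abs_nonneg _).trans (hK 1 0)
  have hθ (x y : ℝ) : |θ * f₂ (θ * x) - θ * f₂ (θ * y)| ≤ K * |x - y| := by
    rw [← mul_sub, abs_mul, abs_of_pos h0]
    have h2 := hK (θ * x) (θ * y)
    rw [← mul_sub, abs_mul, abs_of_pos h0] at h2
    calc θ * |f₂ (θ * x) - f₂ (θ * y)| ≤ 1 * (K * (1 * |x - y|)) := by
          gcongr
          exact h2.trans (by gcongr)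
      _ = _ := by ring
  -- Points on opposite sides are compared through `0`, where both branches vanish.
  have hmix (x y : ℝ) (hx : 0 ≤ x) (hy : y < 0) :
      |f₂ x - θ * f₂ (θ * y)| ≤ K * |x - y| := by
    have h3 := hK x 0
    have h4 := hθ 0 y
    simp only [mul_zero, h.second_zero] at h3 h4
    calc _ = |(f₂ x - 0) + (0 - θ * f₂ (θ * y))| := by ring_nf
      _ ≤ K * |x - 0| + K * |0 - y| := (abs_add_le _ _).trans (add_le_add h3 h4)
      _ = _ := by
        rw [abs_of_nonneg (by linarith : 0 ≤ x - 0), abs_of_pos (by linarith : 0 < 0 - y),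
          abs_of_pos (by linarith : 0 < x - y)]
        ring
  unfold lossRescaleSecond
  split_ifs with hx hy hy
  · exact hK x y
  · exact hmix x y hx (not_le.1 hy)
  · rw [abs_sub_comm, abs_sub_comm x]
    exact hmix y x hy (not_le.1 hx)
  · exact hθ x y

end OddConcave

/-! ### One-stage expansions and their comparison with averaging -/

/-- Expectation of `f (x + r X)` when `X = ± 1` with probability `p / 2` each, and else `X = 0`. -/
noncomputable def stepMean (p r : ℝ) (f : ℝ → ℝ) (x : ℝ) : ℝ :=
  p / 2 * f (x + r) + p / 2 * f (x - r) + (1 - p) * f x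

namespace OddConcave

variable {f f₁ f₂ : ℝ → ℝ} {B θ : ℝ}

theorem abs_stepMean_lossRescale_sub_le (h : OddConcave f f₁ f₂ B) (h0 : 0 < θ) (h1 : θ ≤ 1)
    {K : ℝ} (hK : ∀ x y, |f₂ x - f₂ y| ≤ K * |x - y|) {p r : ℝ} (hp0 : 0 ≤ p) (hp1 : p ≤ 1)
    (hr : 0 ≤ r) (x : ℝ) :
    |stepMean p r (lossRescale θ f) x - lossRescale θ f x
      - r ^ 2 / 2 * p * lossRescaleSecond θ f₂ x| ≤ K * r ^ 3 := by
  have hK0 : 0 ≤ K := by simpa using (abs_nonneg _).trans (hK 1 0)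
  have ht := abs_taylor_two_le (h.hasDerivAt_lossRescale h0) h.hasDerivAt_lossRescale_deriv
    (h.lossRescaleSecond_lipschitz h0 h1 hK) x
  have h2 := ht r
  have h3 := ht (-r)
  rw [abs_neg, abs_of_nonneg hr] at h3
  rw [abs_of_nonneg hr] at h2
  rw [abs_le] at h2 h3 ⊢
  have h4 : K * r ^ 3 * p ≤ K * r ^ 3 := mul_le_of_le_one_right (by positivity) hp1
  rw [stepMean, sub_eq_add_neg x r]
  have e : p / 2 * lossRescale θ f (x + r) + p / 2 * lossRescale θ f (x + -r)
      + (1 - p) * lossRescale θ f x - lossRescale θ f x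
      - r ^ 2 / 2 * p * lossRescaleSecond θ f₂ x
      = p / 2 * (lossRescale θ f (x + r) - lossRescale θ f x
          - r * (if 0 ≤ x then f₁ x else f₁ (θ * x)) - r ^ 2 / 2 * lossRescaleSecond θ f₂ x)
        + p / 2 * (lossRescale θ f (x + -r) - lossRescale θ f x
          - -r * (if 0 ≤ x then f₁ x else f₁ (θ * x))
          - (-r) ^ 2 / 2 * lossRescaleSecond θ f₂ x) := by ring
  rw [e]
  have hp2 : 0 ≤ p / 2 := by linarith
  constructor <;> nlinarith [mul_le_mul_of_nonneg_left h2.1 hp2,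
    mul_le_mul_of_nonneg_left h2.2 hp2, mul_le_mul_of_nonneg_left h3.1 hp2,
    mul_le_mul_of_nonneg_left h3.2 hp2]

/-- On losses the increment is `θ⁻¹ q f₂ (θ x) = P (θ f₂ (θ x))`, since `q = θ² P`. So a single
averaging width yields variance `q` on gains and `P` on losses. -/
theorem abs_lossRescale_intervalAvg_sub_le (h : OddConcave f f₁ f₂ B) (h0 : 0 < θ) (h1 : θ ≤ 1)
    {K : ℝ} (hK : ∀ x y, |f₂ x - f₂ y| ≤ K * |x - y|) {q P r c : ℝ} (hP : θ ^ 2 * P = q)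
    (hc : c ^ 2 = 3 * q) (hc0 : 0 < c) (hr : 0 < r) (x : ℝ) :
    |lossRescale θ (_root_.intervalAvg (c * r) f) x - lossRescale θ f x
      - r ^ 2 / 2 * (if 0 < x then q else P) * lossRescaleSecond θ f₂ x|
      ≤ θ⁻¹ * (K * c ^ 3) * r ^ 3 := by
  have hK0 : 0 ≤ K := by simpa using (abs_nonneg _).trans (hK 1 0)
  have ht := abs_intervalAvg_sub_taylor_le (mul_pos hc0 hr) h.hasDerivAt h.hasDerivAt_deriv hK
  have h2 : 1 ≤ θ⁻¹ := (one_le_inv₀ h0).2 h1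
  have h3 : 0 ≤ K * c ^ 3 * r ^ 3 := by positivity
  rcases lt_or_ge x 0 with hx | hx
  · rw [lossRescaleSecond, lossRescale, lossRescale, if_neg hx.not_ge, if_neg hx.not_ge,
      if_neg hx.not_gt, if_neg hx.not_ge]
    have h4 := mul_le_mul_of_nonneg_left (ht (θ * x)) (inv_pos.2 h0).le
    rw [← abs_of_pos (inv_pos.2 h0), ← abs_mul, abs_of_pos (inv_pos.2 h0)] at h4
    refine le_of_eq_of_le ?_ (h4.trans_eq (by ring))
    congr 1
    rw [mul_pow, hc, ← hP]
    field_simp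
    ring
  -- At `x = 0` the conditional selects `P`, harmlessly, because the second derivative vanishes
  -- there.
  · have e : (if 0 < x then q else P) * lossRescaleSecond θ f₂ x = q * f₂ x := by
      rcases eq_or_lt_of_le hx with rfl | hx'
      · rw [h.lossRescaleSecond_zero, h.second_zero, mul_zero, mul_zero]
      · rw [if_pos hx', lossRescaleSecond, if_pos hx]
    rw [mul_assoc, e, lossRescale, lossRescale, if_pos hx, if_pos hx]
    have h4 := ht x
    calc _ = _ := by
          congr 1
          rw [mul_pow, hc]
          ring
      _ ≤ _ := h4
      _ ≤ _ := by nlinarith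

/-- The deviation of `p` from the desired variance always has the sign opposite to that of the
second derivative. -/
theorem stepMean_lossRescale_le (h : OddConcave f f₁ f₂ B) (h0 : 0 < θ) (h1 : θ ≤ 1)
    {K : ℝ} (hK : ∀ x y, |f₂ x - f₂ y| ≤ K * |x - y|) {p q P r c : ℝ} (hP : θ ^ 2 * P = q)
    (hc : c ^ 2 = 3 * q) (hc0 : 0 < c) (hr : 0 < r) (hq0 : 0 ≤ q) (hP1 : P ≤ 1) (hqp : q ≤ p)
    (hpP : p ≤ P) (x : ℝ) :
    stepMean p r (lossRescale θ f) x ≤ lossRescale θ (_root_.intervalAvg (c * r) f) x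
      + (K + θ⁻¹ * (K * c ^ 3)) * r ^ 3 := by
  have h2 := (abs_le.1 (h.abs_stepMean_lossRescale_sub_le h0 h1 hK (hq0.trans hqp)
    (hpP.trans hP1) hr.le x)).2
  have h3 := (abs_le.1 (h.abs_lossRescale_intervalAvg_sub_le h0 h1 hK hP hc hc0 hr x)).1
  have h4 : r ^ 2 / 2 * ((p - if 0 < x then q else P) * lossRescaleSecond θ f₂ x) ≤ 0 := by
    refine mul_nonpos_of_nonneg_of_nonpos (by positivity) ?_
    split_ifs with hx
    · exact mul_nonpos_of_nonneg_of_nonpos (by linarith) (h.lossRescaleSecond_nonpos hx.le)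
    · exact mul_nonpos_of_nonpos_of_nonneg (by linarith)
        (h.lossRescaleSecond_nonneg h0 (not_lt.1 hx))
  nlinarith

/-- Nothing is asked of `p` relative to the desired variance at `x = 0`, so an arbitrary arm may be
used there, in particular at the first stage. -/
theorem le_stepMean_lossRescale (h : OddConcave f f₁ f₂ B) (h0 : 0 < θ) (h1 : θ ≤ 1)
    {K : ℝ} (hK : ∀ x y, |f₂ x - f₂ y| ≤ K * |x - y|) {p q P r c η : ℝ} (hP : θ ^ 2 * P = q)
    (hc : c ^ 2 = 3 * q) (hc0 : 0 < c) (hr : 0 < r) (hp0 : 0 ≤ p) (hp1 : p ≤ 1) {x : ℝ}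
    (hη : 0 ≤ η) (hx : x ≠ 0 → |p - if 0 < x then q else P| ≤ η) :
    lossRescale θ (_root_.intervalAvg (c * r) f) x ≤ stepMean p r (lossRescale θ f) x
      + (K + θ⁻¹ * (K * c ^ 3)) * r ^ 3 + r ^ 2 / 2 * (η * B) := by
  have h2 := (abs_le.1 (h.abs_stepMean_lossRescale_sub_le h0 h1 hK hp0 hp1 hr.le x)).1
  have h3 := (abs_le.1 (h.abs_lossRescale_intervalAvg_sub_le h0 h1 hK hP hc hc0 hr x)).2
  have hB : 0 ≤ B := (abs_nonneg _).trans (h.abs_second_le 0)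
  have h4 : |(p - if 0 < x then q else P) * lossRescaleSecond θ f₂ x| ≤ η * B := by
    by_cases h5 : x = 0
    · rw [h5, h.lossRescaleSecond_zero, mul_zero, abs_zero]
      positivity
    · rw [abs_mul]
      exact mul_le_mul (hx h5) (h.abs_lossRescaleSecond_le h0 h1 x) (abs_nonneg _) hη
  have h5 := mul_le_mul_of_nonneg_left (abs_le.1 h4).1 (by positivity : 0 ≤ r ^ 2 / 2)
  nlinarith

end OddConcave

/-! ### Approximation of the utility index -/

/-- Integrate `d |u|` from `0`, where `d` is the one-sided derivative: an even integrand has an odd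
primitive. Concavity makes `d` decreasing and monotonicity makes it nonnegative, so `d 0` bounds it.
-/
theorem GainIndex.exists_odd_extension {φ₁ : ℝ → ℝ} (h : GainIndex φ₁) :
    ∃ (g g₁ : ℝ → ℝ) (L : ℝ), (∀ x, 0 ≤ x → g x = φ₁ x) ∧ (∀ x, g (-x) = -g x) ∧
      (∀ x, g₁ (-x) = g₁ x) ∧ (∀ x, HasDerivAt g (g₁ x) x) ∧ Continuous g₁ ∧
      (∀ x, |g₁ x| ≤ L) ∧ AntitoneOn g₁ (Set.Ici 0) := by
  have hcont : ContinuousOn φ₁ (Set.Ici 0) := h.contDiffOn.continuousOn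
  have hdiff : DifferentiableOn ℝ φ₁ (Set.Ici 0) := h.contDiffOn.differentiableOn (by norm_num)
  have hd : ContinuousOn (derivWithin φ₁ (Set.Ici 0)) (Set.Ici 0) :=
    h.contDiffOn.continuousOn_derivWithin (uniqueDiffOn_Ici 0) (by norm_num)
  set d := derivWithin φ₁ (Set.Ici 0) with hd_def
  have hdeq : ∀ x ∈ Set.Ioi (0 : ℝ), d x = derivWithin φ₁ (Set.Ioi 0) x := fun x hx => by
    rw [hd_def, derivWithin_of_mem_nhds (Ici_mem_nhds hx), derivWithin_of_mem_nhds (Ioi_mem_nhds hx)]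
  have hanti' : AntitoneOn d (Set.Ioi 0) :=
    (h.strictConcaveOn.concaveOn.antitoneOn_derivWithin
      (hdiff.mono Set.Ioi_subset_Ici_self)).congr fun x hx => (hdeq x hx).symm
  -- Concavity is given on the open half-line only; continuity of `d` carries the comparison to the
  -- endpoint.
  have hzero : ∀ y, 0 < y → d y ≤ d 0 := fun y hy => by
    refine ge_of_tendsto ((hd 0 Set.self_mem_Ici).mono_left
      (nhdsWithin_mono 0 Set.Ioi_subset_Ici_self)) ?_
    filter_upwards [self_mem_nhdsWithin, nhdsWithin_le_nhds (eventually_lt_nhds hy)] with t ht hty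
    exact hanti' ht hy hty.le
  have hanti : AntitoneOn d (Set.Ici 0) := by
    intro x hx y hy hxy
    rcases eq_or_lt_of_le (Set.mem_Ici.1 hx) with rfl | hx
    · rcases eq_or_lt_of_le (Set.mem_Ici.1 hy) with rfl | hy
      · exact le_rfl
      · exact hzero y hy
    · exact hanti' hx (hx.trans_le hxy) hxy
  have hpos : ∀ x, 0 < x → 0 ≤ d x := fun x hx => by
    rw [hdeq x hx]
    exact h.strictMonoOn.monotoneOn.derivWithin_nonneg
  have hnn : ∀ x, 0 ≤ x → 0 ≤ d x := fun x hx => by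
    rcases eq_or_lt_of_le hx with rfl | hx
    · exact (hpos 1 one_pos).trans (hzero 1 one_pos)
    · exact hpos x hx
  have hc : Continuous fun x : ℝ => d |x| := by
    rw [← continuousOn_univ]
    exact hd.comp continuous_abs.continuousOn fun x _ => abs_nonneg x
  refine ⟨fun x => ∫ u in (0 : ℝ)..x, d |u|, fun x => d |x|, d 0, fun x hx => ?_, fun x => ?_,
    fun x => by simp only [abs_neg], fun x => (hc.integral_hasStrictDerivAt 0 x).hasDerivAt, hc,
    fun x => ?_, fun x hx y hy hxy => ?_⟩
  · beta_reduce
    rw [intervalIntegral.integral_eq_sub_of_hasDerivAt_of_le hx (f := φ₁)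
      (hcont.mono Set.Icc_subset_Ici_self) (fun y hy => ?_) (hc.intervalIntegrable _ _),
      h.map_zero, sub_zero]
    rw [abs_of_pos hy.1]
    exact (hdiff y hy.1.le).hasDerivWithinAt.hasDerivAt (Ici_mem_nhds hy.1)
  · have := intervalIntegral.integral_comp_neg (a := 0) (b := x) (fun u => d |u|)
    simp only [abs_neg, neg_zero] at this
    simp only [this]
    rw [intervalIntegral.integral_symm]
  · rw [abs_of_nonneg (hnn _ (abs_nonneg x))]
    exact hanti (Set.mem_Ici.2 le_rfl) (Set.mem_Ici.2 (abs_nonneg x)) (abs_nonneg x)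
  · simp only [abs_of_nonneg (Set.mem_Ici.1 hx), abs_of_nonneg (Set.mem_Ici.1 hy)]
    exact hanti hx hy hxy

/-- The odd extension is only known to be `C¹`. One averaging gives a bounded continuous second
derivative, another makes it Lipschitz; each moves the function by at most `L * ε`. -/
theorem GainIndex.exists_oddConcave_approx {φ₁ : ℝ → ℝ} (h : GainIndex φ₁) {θ : ℝ} (h0 : 0 < θ)
    (h1 : θ ≤ 1) {η : ℝ} (hη : 0 < η) :
    ∃ (f f₁ f₂ : ℝ → ℝ) (B K : ℝ), OddConcave f f₁ f₂ B ∧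
      (∀ x y, |f₂ x - f₂ y| ≤ K * |x - y|) ∧
      ∀ x, |lossRescale θ f x - utilityIndex φ₁ θ 0 x| ≤ η := by
  obtain ⟨g, g₁, L, hg, hodd, heven, hder, hc, hL, ha⟩ := h.exists_odd_extension
  have hgc : Continuous g := continuous_iff_continuousAt.2 fun x => (hder x).continuousAt
  have hL0 : 0 ≤ L := (abs_nonneg _).trans (hL 0)
  obtain ⟨ε, hε, hε'⟩ : ∃ ε : ℝ, 0 < ε ∧ θ⁻¹ * (2 * L * ε) ≤ η := by
    -- The `+ 1` covers `L = 0`; the factor `θ` absorbs the `θ⁻¹` of the losses.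
    refine ⟨η * θ / (2 * L + 1), by positivity, ?_⟩
    have : θ⁻¹ * (2 * L * (η * θ / (2 * L + 1))) = η * (2 * L / (2 * L + 1)) := by field_simp
    rw [this]
    exact mul_le_of_le_one_right hη.le ((div_le_one (by positivity)).2 (by linarith))
  have hgl := abs_sub_le_of_abs_hasDerivAt_le hder hL
  have hA := OddConcave.intervalAvg_of_antitoneOn hε hodd heven hder hc hL ha
  refine ⟨_, _, _, _, _, hA.intervalAvg hε, hA.lipschitz_intervalAvg_second hε, fun x => ?_⟩
  have e : utilityIndex φ₁ θ 0 x = lossRescale θ g x := by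
    unfold utilityIndex lossRescale
    simp only [sub_zero]
    split_ifs with hx
    · rw [hg x hx]
    · have : 0 ≤ -θ * x := by nlinarith [not_le.1 hx]
      rw [← hg _ this, neg_mul θ, hodd]
      ring
  have h2 (x : ℝ) : |intervalAvg ε g x - g x| ≤ L * ε := by
    have := abs_intervalAvg_sub_le hε hgc (continuous_const (y := g x)) (x := x) (y := x)
      (C := L * ε) fun u hu => by
        refine (hgl _ _).trans ?_
        rw [add_sub_cancel_left]
        gcongr
    rwa [intervalAvg_const hε] at this
  have h3 (x : ℝ) : |intervalAvg ε (intervalAvg ε g) x - g x| ≤ 2 * L * ε := by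
    have h4 := abs_intervalAvg_sub_le hε (continuous_intervalAvg (δ := ε) hgc) hgc
      (x := x) (y := x) (C := L * ε) fun u _ => h2 _
    calc _ = |(intervalAvg ε (intervalAvg ε g) x - intervalAvg ε g x)
            + (intervalAvg ε g x - g x)| := by ring_nf
      _ ≤ L * ε + L * ε := (abs_add_le _ _).trans (add_le_add h4 (h2 x))
      _ = _ := by ring
  rw [e]
  exact (abs_lossRescale_sub_le h0 h1 h3 x).trans hε'

/-! ### One-step disintegration of the path law -/

/-- The first `n` outcomes of an outcome sequence. -/
def outcomePrefix (n : ℕ) (ω : ℕ → Outcome) : Fin n → Outcome := fun i => ω i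

theorem init_outcomePrefix (n : ℕ) (ω : ℕ → Outcome) :
    (Fin.init (outcomePrefix (n + 1) ω) : Fin n → Outcome) = outcomePrefix n ω := rfl

theorem measurable_outcomePrefix (n : ℕ) : Measurable (outcomePrefix n) := by
  unfold outcomePrefix
  fun_prop

theorem integrable_outcomePrefix (B : Beliefs) (s : Strategy) (n : ℕ)
    (F : (Fin n → Outcome) → ℝ) :
    Integrable (fun ω => F (outcomePrefix n ω)) (pathLaw B s) := by
  have : Integrable F ((pathLaw B s).map (outcomePrefix n)) := by
    have := Measure.isProbabilityMeasure_map (μ := pathLaw B s)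
      (measurable_outcomePrefix n).aemeasurable
    exact Integrable.of_finite
  exact this.comp_measurable (measurable_outcomePrefix n)

theorem pathLaw_map_zero (B : Beliefs) (s : Strategy) :
    (pathLaw B s).map (fun ω => ω 0) = (stepLaw B s 0 Fin.elim0).toMeasure := by
  have : IsProbabilityMeasure (stepLaw B s 0 Fin.elim0).toMeasure :=
    PMF.toMeasure.isProbabilityMeasure _
  have h : (fun ω : ℕ → Outcome => ω 0) =
      (fun y : ((i : Finset.Iic 0) → Outcome) => y ⟨0, by simp⟩) ∘ Preorder.frestrictLe 0 := rfl
  rw [h, ← Measure.map_map (by fun_prop) (by fun_prop), pathLaw, Kernel.trajMeasure,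
    Measure.map_comp _ _ (by fun_prop), Kernel.traj_map_frestrictLe, Kernel.partialTraj_self,
    Measure.id_comp, Measure.map_map (by fun_prop) (by fun_prop)]
  exact Measure.map_id

/-- The tower property for one stage. Stage `0` is separate because its law is the initial measure
of the Ionescu-Tulcea construction, not one of its kernels. -/
theorem integral_pathLaw_step (B : Beliefs) (s : Strategy) (n : ℕ)
    (F : (Fin n → Outcome) → Outcome → ℝ) :
    ∫ ω, F (outcomePrefix n ω) (ω n) ∂(pathLaw B s) =
      ∫ ω, ∑ x, (stepLaw B s n (outcomePrefix n ω) x).toReal * F (outcomePrefix n ω) x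
        ∂(pathLaw B s) := by
  have hsum (p : PMF Outcome) (f : Outcome → ℝ) :
      ∫ x, f x ∂p.toMeasure = ∑ x, (p x).toReal * f x := by
    rw [PMF.integral_eq_sum]
    rfl
  cases n with
  | zero =>
    have h0 (ω : ℕ → Outcome) : outcomePrefix 0 ω = Fin.elim0 := Subsingleton.elim _ _
    simp only [h0, integral_const, probReal_univ, one_smul]
    rw [← hsum, ← pathLaw_map_zero,
      integral_map (measurable_pi_apply 0).aemeasurable
      (measurable_of_countable _).aestronglyMeasurable]
  | succ n =>
    have : IsProbabilityMeasure (stepLaw B s 0 Fin.elim0).toMeasure :=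
      PMF.toMeasure.isProbabilityMeasure _
    have h := Kernel.map_frestrictLe_trajMeasure_compProd_eq_map_trajMeasure
      (X := fun _ => Outcome) (μ₀ := (stepLaw B s 0 Fin.elim0).toMeasure)
      (κ := stepKernel B s) (a := n)
    change (pathLaw B s).map _ ⊗ₘ _ = (pathLaw B s).map _ at h
    let r (y : (i : Finset.Iic n) → Outcome) : Fin (n + 1) → Outcome :=
      fun k => y ⟨k, Finset.mem_Iic.2 (Nat.lt_succ_iff.1 k.isLt)⟩
    let G (z : ((i : Finset.Iic n) → Outcome) × Outcome) : ℝ := F (r z.1) z.2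
    have hm : Measurable fun x : ℕ → Outcome => (Preorder.frestrictLe n x, x (n + 1)) := by
      fun_prop
    have hp := Measure.isProbabilityMeasure_map (μ := pathLaw B s) hm.aemeasurable
    calc _ = ∫ z, G z ∂((pathLaw B s).map fun x => (Preorder.frestrictLe n x, x (n + 1))) :=
          (integral_map hm.aemeasurable (measurable_of_countable G).aestronglyMeasurable).symm
      _ = ∫ y, ∫ x, G (y, x) ∂(stepKernel B s n y)
            ∂((pathLaw B s).map (Preorder.frestrictLe n)) := by
          rw [← h, Measure.integral_compProd (by rw [h]; exact Integrable.of_finite)]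
      _ = ∫ ω, ∫ x, G (Preorder.frestrictLe n ω, x)
            ∂(stepKernel B s n (Preorder.frestrictLe n ω)) ∂(pathLaw B s) :=
          integral_map (by fun_prop) (measurable_of_countable _).aestronglyMeasurable
      _ = _ := by
          congr 1
          ext ω
          exact hsum _ _

/-! ### Predictive variances and learning -/

theorem sum_armProb_mul (p : ℝ) (f : Outcome → ℝ) :
    ∑ x, armProb p x * f x = p / 2 * f 1 + p / 2 * f (-1) + (1 - p) * f 0 := by
  have : (Finset.univ : Finset Outcome) = {0, -1, 1} := by decide
  rw [this, Finset.sum_insert (by decide), Finset.sum_insert (by decide), Finset.sum_singleton]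
  have h1 : ((-1 : SignType) = 0) = False := by decide
  have h2 : ((1 : SignType) = 0) = False := by decide
  simp only [armProb, if_true, h1, h2, if_false]
  ring

namespace TwoArmedBandit

variable (M : TwoArmedBandit)

/-- Predictive variance of an arm when `a` has variance `pLow` with probability `m`. -/
noncomputable def predVar (m : ℝ) : Arm → ℝ
  | .a => m * M.pLow + (1 - m) * M.pHigh
  | .b => m * M.pHigh + (1 - m) * M.pLow

/-- `armProb` is affine in the variance, so a mixture of the two arm laws is again such a law. -/
theorem predProb_eq_armProb (m : ℝ) (arm : Arm) (x : Outcome) :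
    M.predProb m arm x = armProb (M.predVar m arm) x := by
  cases arm <;> simp only [predProb, likLow, likHigh, predVar, armProb] <;> split_ifs <;> ring

theorem predVar_mem {m : ℝ} (hm : m ∈ Set.Icc (0 : ℝ) 1) (arm : Arm) :
    M.predVar m arm ∈ Set.Icc M.pLow M.pHigh := by
  obtain ⟨h0, h1⟩ := hm
  have h := M.pLow_lt_pHigh
  cases arm <;> simp only [predVar] <;> constructor <;> nlinarith

/-- The posterior after the first `n` stages along an outcome sequence when `s` is followed. -/
noncomputable def pathPosterior (s : Strategy) (n : ℕ) (ω : Fin n → Outcome) : ℝ :=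
  M.posterior n (s.actions n ω) ω

theorem pathPosterior_mem (s : Strategy) (n : ℕ) (ω : Fin n → Outcome) :
    M.pathPosterior s n ω ∈ Set.Icc (0 : ℝ) 1 :=
  M.posterior_mem _ _ _

theorem toReal_stepLaw (s : Strategy) (n : ℕ) (ω : Fin n → Outcome) (x : Outcome) :
    (stepLaw M.beliefs s n ω x).toReal =
      M.predProb (M.pathPosterior s n ω) (s n (s.actions n ω) ω) x := by
  simp only [stepLaw, beliefs, PMF.ofFintype_apply, pathPosterior]
  exact ENNReal.toReal_ofReal (M.predProb_nonneg (M.posterior_mem _ _ _) _ _)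

theorem pathPosterior_succ (s : Strategy) (n : ℕ) (ω : ℕ → Outcome) :
    M.pathPosterior s (n + 1) (outcomePrefix (n + 1) ω) =
      M.pathPosterior s n (outcomePrefix n ω) *
          M.likLow (s n (s.actions n (outcomePrefix n ω)) (outcomePrefix n ω)) (ω n) /
        M.predProb (M.pathPosterior s n (outcomePrefix n ω))
          (s n (s.actions n (outcomePrefix n ω)) (outcomePrefix n ω)) (ω n) := by
  simp only [pathPosterior, posterior, Strategy.actions, Fin.init_snoc, Fin.snoc_last,
    init_outcomePrefix]
  rfl

/-! ### Geometric decay of the posterior uncertainty -/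

/-- Hellinger affinity of the outcome laws of the two arms. -/
noncomputable def affinity : ℝ :=
  √((1 - M.pLow) * (1 - M.pHigh)) + √(M.pLow * M.pHigh)

theorem affinity_nonneg : 0 ≤ M.affinity := by
  unfold affinity
  positivity

/-- Each geometric mean is at most the arithmetic mean, and the arithmetic means sum to `1`; `pLow <
pHigh` makes the inequality strict. -/
theorem affinity_lt_one : M.affinity < 1 := by
  have hq := M.pLow_pos
  have hqP := M.pLow_lt_pHigh
  have hP := M.pHigh_lt_one
  unfold affinity
  rw [Real.sqrt_mul (by linarith), Real.sqrt_mul (by linarith)]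
  have h1 := Real.sq_sqrt (by linarith : 0 ≤ 1 - M.pLow)
  have h2 := Real.sq_sqrt (by linarith : 0 ≤ 1 - M.pHigh)
  have h3 := Real.sq_sqrt (by linarith : 0 ≤ M.pLow)
  have h4 := Real.sq_sqrt (by linarith : 0 ≤ M.pHigh)
  have h5 : √M.pLow < √M.pHigh := Real.sqrt_lt_sqrt hq.le hqP
  nlinarith [sq_nonneg (√(1 - M.pLow) - √(1 - M.pHigh)), mul_pos (sub_pos.2 h5) (sub_pos.2 h5)]

theorem predProb_pos {m : ℝ} (hm : m ∈ Set.Icc (0 : ℝ) 1) (arm : Arm) (x : Outcome) :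
    0 < M.predProb m arm x := by
  have := M.predVar_mem hm arm
  rw [predProb_eq_armProb]
  exact armProb_pos (M.pLow_pos.trans_le this.1) (this.2.trans_lt M.pHigh_lt_one) x

/-- In Bayes' rule both posterior weights carry the predictive probability as denominator; the
square root of their product cancels it exactly. -/
theorem predProb_mul_sqrt_posterior {m : ℝ} (hm : m ∈ Set.Icc (0 : ℝ) 1) (arm : Arm)
    (x : Outcome) :
    M.predProb m arm x * √(m * M.likLow arm x / M.predProb m arm x *
        (1 - m * M.likLow arm x / M.predProb m arm x)) =
      √(m * (1 - m)) * √(M.likLow arm x * M.likHigh arm x) := by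
  have hp := M.predProb_pos hm arm x
  have e : m * M.likLow arm x / M.predProb m arm x *
      (1 - m * M.likLow arm x / M.predProb m arm x) =
      (m * (1 - m)) * (M.likLow arm x * M.likHigh arm x) / (M.predProb m arm x) ^ 2 := by
    have : 1 - m * M.likLow arm x / M.predProb m arm x
        = (1 - m) * M.likHigh arm x / M.predProb m arm x := by
      rw [eq_div_iff hp.ne', sub_mul, div_mul_cancel₀ _ hp.ne', predProb]
      ring
    rw [this]
    field_simp
  have h0 : 0 ≤ m * (1 - m) := mul_nonneg hm.1 (sub_nonneg.2 hm.2)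
  rw [e, Real.sqrt_div' _ (sq_nonneg _), Real.sqrt_sq hp.le, Real.sqrt_mul h0]
  field_simp

/-- Changing arms only swaps the two likelihoods, so both arms are equally informative and no
exploration is needed. -/
theorem sum_sqrt_likLow_mul_likHigh (arm : Arm) :
    ∑ x, √(M.likLow arm x * M.likHigh arm x) = M.affinity := by
  have h := M.pLow_pos
  have h' := h.trans M.pLow_lt_pHigh
  have e : √(M.pLow / 2 * (M.pHigh / 2)) = √(M.pLow * M.pHigh) / 2 := by
    rw [show M.pLow / 2 * (M.pHigh / 2) = M.pLow * M.pHigh / 2 ^ 2 by ring,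
      Real.sqrt_div' _ (by positivity), Real.sqrt_sq (by norm_num)]
  have hu : (Finset.univ : Finset Outcome) = {0, -1, 1} := by decide
  have h1 : ((-1 : SignType) = 0) = False := by decide
  have h2 : ((1 : SignType) = 0) = False := by decide
  rw [hu, Finset.sum_insert (by decide), Finset.sum_insert (by decide), Finset.sum_singleton]
  cases arm <;> simp only [likLow, likHigh, armProb, h1, h2, if_true, if_false, affinity]
  · rw [e]
    ring
  · rw [mul_comm (M.pHigh / 2), mul_comm (1 - M.pHigh), e]
    ring

theorem integral_sqrt_posterior_succ (s : Strategy) (n : ℕ) :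
    ∫ ω, √(M.pathPosterior s (n + 1) (outcomePrefix (n + 1) ω) *
        (1 - M.pathPosterior s (n + 1) (outcomePrefix (n + 1) ω))) ∂(pathLaw M.beliefs s) =
      M.affinity * ∫ ω, √(M.pathPosterior s n (outcomePrefix n ω) *
        (1 - M.pathPosterior s n (outcomePrefix n ω))) ∂(pathLaw M.beliefs s) := by
  simp only [pathPosterior_succ]
  rw [integral_pathLaw_step M.beliefs s n fun ω x =>
    √(M.pathPosterior s n ω * M.likLow (s n (s.actions n ω) ω) x /
        M.predProb (M.pathPosterior s n ω) (s n (s.actions n ω) ω) x *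
      (1 - M.pathPosterior s n ω * M.likLow (s n (s.actions n ω) ω) x /
        M.predProb (M.pathPosterior s n ω) (s n (s.actions n ω) ω) x)),
    ← integral_const_mul]
  congr 1
  ext ω
  simp only [toReal_stepLaw, M.predProb_mul_sqrt_posterior (M.pathPosterior_mem s n _),
    ← Finset.mul_sum, sum_sqrt_likLow_mul_likHigh]
  ring

theorem integral_sqrt_posterior_le (s : Strategy) (n : ℕ) :
    ∫ ω, √(M.pathPosterior s n (outcomePrefix n ω) *
        (1 - M.pathPosterior s n (outcomePrefix n ω))) ∂(pathLaw M.beliefs s) ≤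
      M.affinity ^ n := by
  induction n with
  | zero =>
    have h (ω : ℕ → Outcome) : M.pathPosterior s 0 (outcomePrefix 0 ω) = M.prior := rfl
    simp only [h, integral_const, probReal_univ, one_smul, pow_zero]
    refine Real.sqrt_le_one.2 ?_
    nlinarith [M.prior_nonneg, M.prior_le_one]
  | succ n ih =>
    rw [integral_sqrt_posterior_succ, pow_succ']
    exact mul_le_mul_of_nonneg_left ih M.affinity_nonneg

theorem theta_pos : 0 < M.theta :=
  div_pos (Real.sqrt_pos.2 M.pLow_pos) (Real.sqrt_pos.2 (M.pLow_pos.trans M.pLow_lt_pHigh))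

theorem theta_le_one : M.theta ≤ 1 :=
  div_le_one_of_le₀ (Real.sqrt_le_sqrt M.pLow_lt_pHigh.le) (Real.sqrt_nonneg _)

theorem theta_sq_mul : M.theta ^ 2 * M.pHigh = M.pLow := by
  have h := M.pLow_pos.trans M.pLow_lt_pHigh
  rw [theta, div_pow, Real.sq_sqrt M.pLow_pos.le, Real.sq_sqrt h.le]
  field_simp

/-- Sum of the first `n` outcomes. -/
noncomputable def _root_.cumulativePayoff (n : ℕ) (ω : Fin n → Outcome) : ℝ :=
  ∑ i, ((ω i : Outcome) : ℝ)

theorem _root_.cumulativePayoff_succ (n : ℕ) (ω : ℕ → Outcome) :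
    cumulativePayoff (n + 1) (outcomePrefix (n + 1) ω) =
      cumulativePayoff n (outcomePrefix n ω) + ((ω n : Outcome) : ℝ) := by
  rw [cumulativePayoff, Fin.sum_univ_castSucc]
  rfl

theorem min_le_sqrt_mul {m : ℝ} (hm : m ∈ Set.Icc (0 : ℝ) 1) :
    min m (1 - m) ≤ √(m * (1 - m)) := by
  have h0 := hm.1
  have h1 := sub_nonneg.2 hm.2
  refine Real.le_sqrt_of_sq_le ?_
  rw [sq]
  exact mul_le_mul (min_le_left _ _) (min_le_right _ _) (le_min h0 h1) h0

/-- The myopic strategy misses the desired variance by at most the error of the posterior. -/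
theorem abs_predVar_myopic_sub_le (n : ℕ) (ω : Fin n → Outcome)
    (h : cumulativePayoff n ω ≠ 0) :
    |M.predVar (M.pathPosterior M.myopic n ω) (M.myopic n (M.myopic.actions n ω) ω) -
        if 0 < cumulativePayoff n ω then M.pLow else M.pHigh| ≤
      (M.pHigh - M.pLow) * √(M.pathPosterior M.myopic n ω * (1 - M.pathPosterior M.myopic n ω)) := by
  -- A nonzero payoff excludes the first stage, where the arm is fixed by convention.
  have hn : n ≠ 0 := by
    rintro rfl
    exact h (by simp [cumulativePayoff])
  have hm := M.pathPosterior_mem M.myopic n ω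
  have hd := sub_pos.2 M.pLow_lt_pHigh
  refine le_trans ?_ (mul_le_mul_of_nonneg_left (min_le_sqrt_mul hm) hd.le)
  have e : M.myopic n (M.myopic.actions n ω) ω =
      if (cumulativePayoff n ω ≤ 0 ∧ M.pathPosterior M.myopic n ω < 1 / 2) ∨
        (0 < cumulativePayoff n ω ∧ 1 / 2 < M.pathPosterior M.myopic n ω)
      then Arm.a else Arm.b := by
    simp only [myopic, hn, false_or]
    rfl
  rw [e]
  generalize M.pathPosterior M.myopic n ω = m at *
  obtain ⟨h0, h1⟩ := hm
  -- In each case the error is `pHigh - pLow` times the posterior weight of the less likely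
  -- identification; a tie at `1 / 2` is immaterial.
  rcases lt_or_ge 0 (cumulativePayoff n ω) with hS | hS
  · simp only [hS, hS.not_ge, false_and, true_and, false_or, if_true]
    split_ifs with hh
    · rw [predVar, min_eq_right (by linarith), abs_of_nonneg (by nlinarith)]
      linarith
    · rw [predVar, min_eq_left (by linarith), abs_of_nonneg (by nlinarith)]
      linarith
  · simp only [hS, hS.not_gt, false_and, true_and, or_false, if_false]
    split_ifs with hh
    · rw [predVar, min_eq_left (by linarith), abs_of_nonpos (by nlinarith)]
      linarith
    · rw [predVar, min_eq_right (by linarith), abs_of_nonpos (by nlinarith)]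
      linarith

theorem integral_comp_cumulativePayoff_succ (s : Strategy) (n : ℕ) (r : ℝ) (v : ℝ → ℝ) :
    ∫ ω, v (r * cumulativePayoff (n + 1) (outcomePrefix (n + 1) ω)) ∂(pathLaw M.beliefs s) =
      ∫ ω, stepMean (M.predVar (M.pathPosterior s n (outcomePrefix n ω))
          (s n (s.actions n (outcomePrefix n ω)) (outcomePrefix n ω))) r v
        (r * cumulativePayoff n (outcomePrefix n ω)) ∂(pathLaw M.beliefs s) := by
  simp only [cumulativePayoff_succ]
  rw [integral_pathLaw_step M.beliefs s n fun ω x =>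
    v (r * (cumulativePayoff n ω + ((x : Outcome) : ℝ)))]
  congr 1
  ext ω
  simp only [toReal_stepLaw, predProb_eq_armProb]
  rw [sum_armProb_mul, stepMean]
  simp [mul_add, sub_eq_add_neg]

end TwoArmedBandit

/-! ### The value of the game vanishes in the limit -/

namespace TwoArmedBandit

variable (M : TwoArmedBandit)

theorem expectedUtility_eq (B : Beliefs) (φ : ℝ → ℝ) (n : ℕ) (s : Strategy) :
    expectedUtility B φ n s =
      ∫ ω, φ ((√n)⁻¹ * cumulativePayoff n (outcomePrefix n ω)) ∂(pathLaw B s) := by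
  unfold expectedUtility cumulativePayoff outcomePrefix
  congr 1
  ext ω
  rw [← Fin.sum_univ_eq_sum_range (fun i => ((ω i : Outcome) : ℝ)) n, div_eq_inv_mul]

theorem abs_integral_sub_integral_le {B : Beliefs} {s : Strategy} {n : ℕ} {φ v : ℝ → ℝ} {η r : ℝ}
    (h : ∀ x, |v x - φ x| ≤ η) :
    |∫ ω, v (r * cumulativePayoff n (outcomePrefix n ω)) ∂(pathLaw B s) -
      ∫ ω, φ (r * cumulativePayoff n (outcomePrefix n ω)) ∂(pathLaw B s)| ≤ η := by
  rw [← integral_sub (integrable_outcomePrefix B s n fun y => v (r * cumulativePayoff n y))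
    (integrable_outcomePrefix B s n fun y => φ (r * cumulativePayoff n y))]
  have := norm_integral_le_of_norm_le_const (μ := pathLaw B s) (f := fun ω =>
    v (r * cumulativePayoff n (outcomePrefix n ω)) - φ (r * cumulativePayoff n (outcomePrefix n ω)))
    (Eventually.of_forall fun ω => h _)
  simpa using this

section Telescoping

variable {f f₁ f₂ : ℝ → ℝ} {B K : ℝ}

/-- Expected value after `k` stages of the limiting control problem with `j` stages to go. -/
noncomputable def stageValue (f : ℝ → ℝ) (s : Strategy) (r : ℝ) (k j : ℕ) : ℝ :=
  ∫ ω, lossRescale M.theta ((intervalAvg (√(3 * M.pLow) * r))^[j] f)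
    (r * cumulativePayoff k (outcomePrefix k ω)) ∂(pathLaw M.beliefs s)

theorem sqrt_three_mul_pLow_pos : 0 < √(3 * M.pLow) :=
  Real.sqrt_pos.2 (mul_pos three_pos M.pLow_pos)

theorem sq_sqrt_three_mul_pLow : √(3 * M.pLow) ^ 2 = 3 * M.pLow :=
  Real.sq_sqrt (mul_pos three_pos M.pLow_pos).le

/-- Constant in the error of one stage. -/
noncomputable def stageConst (K : ℝ) : ℝ := K + M.theta⁻¹ * (K * √(3 * M.pLow) ^ 3)

/-- The play starts at the reference point, where every averaged odd function vanishes; this is why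
the limit is `0`. -/
theorem stageValue_zero_left (h : OddConcave f f₁ f₂ B)
    (hK : ∀ x y, |f₂ x - f₂ y| ≤ K * |x - y|) (s : Strategy) {r : ℝ} (hr : 0 < r) (j : ℕ) :
    M.stageValue f s r 0 j = 0 := by
  have h2 := (h.intervalAvg_iterate (mul_pos M.sqrt_three_mul_pLow_pos hr) hK j).1.map_zero
  simp only [stageValue, cumulativePayoff, Finset.univ_eq_empty, Finset.sum_empty, mul_zero,
    lossRescale, le_refl, if_true, h2, integral_zero]

theorem stageValue_succ_le (h : OddConcave f f₁ f₂ B)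
    (hK : ∀ x y, |f₂ x - f₂ y| ≤ K * |x - y|) (s : Strategy) {r : ℝ} (hr : 0 < r) (k j : ℕ) :
    M.stageValue f s r (k + 1) j ≤ M.stageValue f s r k (j + 1) + M.stageConst K * r ^ 3 := by
  obtain ⟨h2, hK2⟩ := h.intervalAvg_iterate (mul_pos M.sqrt_three_mul_pLow_pos hr) hK j
  have hint (F : (Fin k → Outcome) → ℝ) := integrable_outcomePrefix M.beliefs s k F
  rw [stageValue, integral_comp_cumulativePayoff_succ, stageValue]
  calc _ ≤ ∫ ω, (lossRescale M.theta ((intervalAvg (√(3 * M.pLow) * r))^[j + 1] f)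
        (r * cumulativePayoff k (outcomePrefix k ω)) + M.stageConst K * r ^ 3)
          ∂(pathLaw M.beliefs s) := by
        refine integral_mono (hint fun y => stepMean (M.predVar (M.pathPosterior s k y)
          (s k (s.actions k y) y)) r _ (r * cumulativePayoff k y))
          (hint fun y => lossRescale M.theta _ (r * cumulativePayoff k y) + _) fun ω => ?_
        have hp := M.predVar_mem (M.pathPosterior_mem s k (outcomePrefix k ω))
          (s k (s.actions k (outcomePrefix k ω)) (outcomePrefix k ω))
        rw [Function.iterate_succ_apply']
        exact h2.stepMean_lossRescale_le M.theta_pos M.theta_le_one hK2 M.theta_sq_mul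
          M.sq_sqrt_three_mul_pLow M.sqrt_three_mul_pLow_pos hr M.pLow_pos.le
          M.pHigh_lt_one.le hp.1 hp.2 _
    _ = _ := by
        rw [integral_add (hint fun y => lossRescale M.theta _ (r * cumulativePayoff k y))
          (integrable_const _)]
        simp

/-- The learning error has expectation at most `affinity ^ k`, hence is summable over the stages and
still carries the factor `r ^ 2`. -/
theorem le_stageValue_myopic_succ (h : OddConcave f f₁ f₂ B)
    (hK : ∀ x y, |f₂ x - f₂ y| ≤ K * |x - y|) {r : ℝ} (hr : 0 < r) (k j : ℕ) :
    M.stageValue f M.myopic r k (j + 1) ≤ M.stageValue f M.myopic r (k + 1) j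
      + M.stageConst K * r ^ 3 + r ^ 2 / 2 * ((M.pHigh - M.pLow) * B) * M.affinity ^ k := by
  obtain ⟨h2, hK2⟩ := h.intervalAvg_iterate (mul_pos M.sqrt_three_mul_pLow_pos hr) hK j
  have hint (F : (Fin k → Outcome) → ℝ) := integrable_outcomePrefix M.beliefs M.myopic k F
  have hB : 0 ≤ B := (abs_nonneg _).trans (h.abs_second_le 0)
  have hd := sub_pos.2 M.pLow_lt_pHigh
  rw [stageValue, stageValue, integral_comp_cumulativePayoff_succ]
  let H (y : Fin k → Outcome) : ℝ :=
    √(M.pathPosterior M.myopic k y * (1 - M.pathPosterior M.myopic k y))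
  let G (y : Fin k → Outcome) : ℝ := stepMean (M.predVar (M.pathPosterior M.myopic k y)
    (M.myopic k (M.myopic.actions k y) y)) r
    (lossRescale M.theta ((intervalAvg (√(3 * M.pLow) * r))^[j] f)) (r * cumulativePayoff k y)
  calc _ ≤ ∫ ω, (G (outcomePrefix k ω) + M.stageConst K * r ^ 3
          + r ^ 2 / 2 * ((M.pHigh - M.pLow) * B) * H (outcomePrefix k ω))
          ∂(pathLaw M.beliefs M.myopic) := by
        refine integral_mono (hint fun y => lossRescale M.theta _ (r * cumulativePayoff k y))
          (hint fun y => G y + M.stageConst K * r ^ 3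
            + r ^ 2 / 2 * ((M.pHigh - M.pLow) * B) * H y) fun ω => ?_
        have hp := M.predVar_mem (M.pathPosterior_mem M.myopic k (outcomePrefix k ω))
          (M.myopic k (M.myopic.actions k (outcomePrefix k ω)) (outcomePrefix k ω))
        have := h2.le_stepMean_lossRescale M.theta_pos M.theta_le_one hK2 M.theta_sq_mul
          M.sq_sqrt_three_mul_pLow M.sqrt_three_mul_pLow_pos hr (M.pLow_pos.le.trans hp.1)
          (hp.2.trans M.pHigh_lt_one.le) (x := r * cumulativePayoff k (outcomePrefix k ω))
          (η := (M.pHigh - M.pLow) * H (outcomePrefix k ω)) (by positivity) fun hx => by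
            simp only [mul_pos_iff_of_pos_left hr]
            exact M.abs_predVar_myopic_sub_le k _ (right_ne_zero_of_mul hx)
        rw [Function.iterate_succ_apply']
        refine this.trans (le_of_eq ?_)
        simp only [G, stageConst]
        ring
    _ = (∫ ω, G (outcomePrefix k ω) ∂(pathLaw M.beliefs M.myopic)) + M.stageConst K * r ^ 3
          + r ^ 2 / 2 * ((M.pHigh - M.pLow) * B) *
            ∫ ω, H (outcomePrefix k ω) ∂(pathLaw M.beliefs M.myopic) := by
        rw [integral_add (hint fun y => G y + M.stageConst K * r ^ 3)
          ((hint H).const_mul _), integral_add (hint G) (integrable_const _),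
          integral_const, integral_const_mul, probReal_univ, one_smul]
    _ ≤ _ := by
        gcongr
        exact M.integral_sqrt_posterior_le M.myopic k

theorem stageValue_le (h : OddConcave f f₁ f₂ B)
    (hK : ∀ x y, |f₂ x - f₂ y| ≤ K * |x - y|) (s : Strategy) {r : ℝ} (hr : 0 < r) (k j : ℕ) :
    M.stageValue f s r k j ≤ k * (M.stageConst K * r ^ 3) := by
  induction k generalizing j with
  | zero => simp [M.stageValue_zero_left h hK s hr]
  | succ k ih =>
    have := M.stageValue_succ_le h hK s hr k j
    push_cast
    linarith [ih (j + 1)]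

theorem le_stageValue_myopic (h : OddConcave f f₁ f₂ B)
    (hK : ∀ x y, |f₂ x - f₂ y| ≤ K * |x - y|) {r : ℝ} (hr : 0 < r) (k j : ℕ) :
    -(k * (M.stageConst K * r ^ 3) + r ^ 2 / 2 * ((M.pHigh - M.pLow) * B) *
      ∑ i ∈ Finset.range k, M.affinity ^ i) ≤ M.stageValue f M.myopic r k j := by
  induction k generalizing j with
  | zero => simp [M.stageValue_zero_left h hK M.myopic hr]
  | succ k ih =>
    have := M.le_stageValue_myopic_succ h hK hr k j
    rw [Finset.sum_range_succ]
    push_cast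
    linarith [ih (j + 1)]

end Telescoping

variable {φ₁ : ℝ → ℝ}

theorem eventually_expectedUtility_le (hφ₁ : GainIndex φ₁) {η : ℝ} (hη : 0 < η) :
    ∀ᶠ n : ℕ in atTop, (∀ s, expectedUtility M.beliefs (utilityIndex φ₁ M.theta 0) n s ≤ η) ∧
      -η ≤ expectedUtility M.beliefs (utilityIndex φ₁ M.theta 0) n M.myopic := by
  obtain ⟨f, f₁, f₂, B, K, hf, hK, happ⟩ :=
    hφ₁.exists_oddConcave_approx M.theta_pos M.theta_le_one (half_pos hη)
  have hB : 0 ≤ B := (abs_nonneg _).trans (hf.abs_second_le 0)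
  have hd := sub_pos.2 M.pLow_lt_pHigh
  have hr : Tendsto (fun n : ℕ => (√(n : ℝ))⁻¹) atTop (𝓝 0) :=
    tendsto_inv_atTop_zero.comp (Real.tendsto_sqrt_atTop.comp tendsto_natCast_atTop_atTop)
  -- With `r = 1 / √n` the `n` stage errors of order `r ^ 3` add up to order `r`. Half of `η` pays
  -- for these and for learning, the other half for smoothing the utility.
  have hlim : Tendsto (fun n : ℕ => M.stageConst K * (√(n : ℝ))⁻¹ +
      ((√(n : ℝ))⁻¹) ^ 2 / 2 * ((M.pHigh - M.pLow) * B) * (1 - M.affinity)⁻¹) atTop (𝓝 0) := by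
    have := (hr.const_mul (M.stageConst K)).add (((((hr.pow 2).div_const 2)).mul_const
      ((M.pHigh - M.pLow) * B)).mul_const (1 - M.affinity)⁻¹)
    simpa using this
  have ha := sub_pos.2 M.affinity_lt_one
  filter_upwards [eventually_gt_atTop 0, hlim.eventually (gt_mem_nhds (half_pos hη))] with n hn hn2
  have hn0 : (0 : ℝ) < n := Nat.cast_pos.2 hn
  have hr0 : 0 < (√(n : ℝ))⁻¹ := inv_pos.2 (Real.sqrt_pos.2 hn0)
  have hnr : (n : ℝ) * (M.stageConst K * ((√(n : ℝ))⁻¹) ^ 3) = M.stageConst K * (√(n : ℝ))⁻¹ := by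
    have : (n : ℝ) * ((√(n : ℝ))⁻¹) ^ 2 = 1 := by
      rw [inv_pow, Real.sq_sqrt hn0.le, mul_inv_cancel₀ hn0.ne']
    linear_combination M.stageConst K * (√(n : ℝ))⁻¹ * this
  have herr : 0 ≤ ((√(n : ℝ))⁻¹) ^ 2 / 2 * ((M.pHigh - M.pLow) * B) := by positivity
  have hgeom : ∑ i ∈ Finset.range n, M.affinity ^ i ≤ (1 - M.affinity)⁻¹ :=
    (summable_geometric_of_lt_one M.affinity_nonneg M.affinity_lt_one).sum_le_tsum _
      (fun i _ => pow_nonneg M.affinity_nonneg i) |>.trans_eq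
      (tsum_geometric_of_lt_one M.affinity_nonneg M.affinity_lt_one)
  have hcmp (s : Strategy) : |M.stageValue f s (√(n : ℝ))⁻¹ n 0 -
      expectedUtility M.beliefs (utilityIndex φ₁ M.theta 0) n s| ≤ η / 2 := by
    rw [expectedUtility_eq]
    exact abs_integral_sub_integral_le happ
  refine ⟨fun s => ?_, ?_⟩
  · have h1 := M.stageValue_le hf hK s hr0 n 0
    rw [hnr] at h1
    have h2 := (abs_le.1 (hcmp s)).1
    have h3 := mul_nonneg herr (inv_pos.2 ha).le
    linarith
  · have h1 := M.le_stageValue_myopic hf hK hr0 n 0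
    rw [hnr] at h1
    have h2 := (abs_le.1 (hcmp M.myopic)).2
    have h3 := mul_le_mul_of_nonneg_left hgeom herr
    linarith

end TwoArmedBandit

theorem theorem4 (M : TwoArmedBandit) (φ₁ : ℝ → ℝ) (hφ₁ : GainIndex φ₁) :
    AsymptoticallyOptimal M.beliefs (utilityIndex φ₁ M.theta 0) M.myopic := by
  have : Nonempty Strategy := ⟨M.myopic⟩
  have hle (n : ℕ) : expectedUtility M.beliefs (utilityIndex φ₁ M.theta 0) n M.myopic ≤
      value M.beliefs (utilityIndex φ₁ M.theta 0) n :=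
    le_ciSup (bddAbove_expectedUtility _ _ n) M.myopic
  -- Both sequences are squeezed by `-ε / 2 ≤ U_n(s*) ≤ V_n ≤ ε / 2`.
  refine ⟨0, ?_, ?_⟩ <;> rw [Metric.tendsto_atTop'] <;> intro ε hε <;>
    obtain ⟨N, hN⟩ := eventually_atTop.1 (M.eventually_expectedUtility_le hφ₁ (half_pos hε)) <;>
    refine ⟨N, fun n hn => ?_⟩ <;> obtain ⟨h1, h2⟩ := hN n hn.le <;>
    rw [Real.dist_eq, sub_zero, abs_lt]
  · have h3 : value M.beliefs (utilityIndex φ₁ M.theta 0) n ≤ ε / 2 := ciSup_le h1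
    exact ⟨by linarith [hle n], by linarith⟩
  · exact ⟨by linarith, by linarith [h1 M.myopic]⟩
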